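/- A bipartite graph $\Gamma=(V_1,E,V_2)$ is a finite graph with an ordered pair of vertex sets $V_1,V_2$ in which every edge $e\in E$ joins a vertex $V_1(e)\in V_1$ with a vertex $V_2(e)\in V_2$; multiple edges are allowed and every vertex is an end of some edge. Isomorphisms preserve the order of $(V_1,V_2)$ and consist of bijections of $V_1$, $E$ and $V_2$; $\operatorname{Aut}(\Gamma)$ is the group of automorphisms. The degree is $|\Gamma|=|E|$. A graph is simple if each of its connected components has exactly two vertices. Let $B_n$ be the complex vector space with basis the isomorphism classes of bipartite graphs of degree $n$. Product on $B_n$. For graphs $\Gamma=(V_1,E,V_2)$ and $\Gamma'=(V_1',E',V_2')$ of degree $n$ consider the pairs $(\chi,F)$ of a valency-preserving map $\chi:V_2\to V_1'$ and a bijection $F:E\to E'$ with $\chi(V_2(e))=V_1'(F(e))$ for all $e\in E$. Let $(V_1,\overline F,V_2')$ be the graph whose edges are the pairs $(e,F(e))$, joining $V_1(e)$ with $V_2'(F(e))$, and let $\operatorname{Aut}_F$ be the group of those automorphisms of $(V_1,\overline F,V_2')$ that induce on $E$ an automorphism of $\Gamma$. Then $$[\Gamma]*[\Gamma']=\sum_{(\chi,F)}\frac{|\operatorname{Aut}(V_1,\overline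 F,V_2')|}{|\operatorname{Aut}_F(V_1,\overline F,V_2')|}\,[(V_1,\overline F,V_2')],$$ where the sum is over the pairs $(\chi,F)$ up to the action of $\operatorname{Aut}(\Gamma)\times\operatorname{Aut}(\Gamma')$; the product is extended bilinearly. For $m\le n$ let $\rho^B_n:B_m\to B_n$ be the linear map with $$\rho^B_n(\Gamma)=\sum_{S}\frac{|\operatorname{Aut}(\Gamma\sqcup S)|}{|\operatorname{Aut}(\Gamma)|\,|\operatorname{Aut}(S)|}\,[\Gamma\sqcup S],$$ the sum being over the isomorphism classes of simple graphs $S$ of degree $n-m$ (the empty graph if $n=m$). Let $B_\infty=\bigoplus_{n\ge1}B_n$ be the vector space generated by all bipartite graphs of positive degree. For graphs $\Gamma_1,\Gamma_2$ put $M=\max(|\Gamma_1|,|\Gamma_2|)$, and define recursively, for $n\ge M$, $$\{\Gamma_1\Gamma_2\}_n=\rho^B_n(\Gamma_1)*\rho^B_n(\Gamma_2)-\sum_{k=M}^{n-1}\rho^B_n(\{\Gamma_1\Gamma_2\}_k)\in B_n .$$ The product of $B_\infty$ is the bilinear extension of $\Gamma_1\circ\Gamma_2=\sum_{n\ge M}\{\Gamma_1\Gamma_2\}_n$.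 Let $B^{as}=\prod_{n\ge1}B_n$ with componentwise operations. **Theorem.** For graphs of positive degree, $\{\Gamma_1\Gamma_2\}_n=0$ whenever $n>|\Gamma_1|+|\Gamma_2|$, so that $\circ$ is well defined, and the algebras $(B_\infty,\circ)$ and $(B^{as},*)$ are associative. There is an injective homomorphism of complex algebras (not required to preserve units) $$\rho^B_\uparrow:B_\infty\to B^{as}$$ which sends each $b\in B_n$, $n\ge1$, to the sequence $(b^1,b^2,\dots)$ with $b^i=0$ for $i<n$ and $b^i=\rho^B_i(b)$ for $i\ge n$. -/

import Mathlib

noncomputable section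

/-- A finite bipartite graph `(V₁, E, V₂)`: an ordered pair of vertex sets and a set of edges, every
edge joining a vertex of `V₁` with a vertex of `V₂`.  Multiple edges are allowed, and every vertex is
an end of some edge. -/
structure BipartiteGraph : Type 1 where
  V₁ : Type
  E : Type
  V₂ : Type
  finE : Finite E
  left : E → V₁
  right : E → V₂
  left_surj : Function.Surjective left
  right_surj : Function.Surjective right

namespace BipartiteGraph

instance (Γ : BipartiteGraph) : Finite Γ.E := Γ.finE
instance (Γ : BipartiteGraph) : Finite Γ.V₁ := Finite.of_surjective _ Γ.left_surj
instance (Γ : BipartiteGraph) : Finite Γ.V₂ := Finite.of_surjective _ Γ.right_surj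

/-- The degree of a bipartite graph is its number of edges. -/
def degree (Γ : BipartiteGraph) : ℕ := Nat.card Γ.E

/-- Isomorphisms of bipartite graphs; they respect the order of the two vertex sets. -/
@[ext]
structure Iso (Γ Γ' : BipartiteGraph) where
  onV₁ : Γ.V₁ ≃ Γ'.V₁
  onE : Γ.E ≃ Γ'.E
  onV₂ : Γ.V₂ ≃ Γ'.V₂
  left_comm : ∀ e, Γ'.left (onE e) = onV₁ (Γ.left e)
  right_comm : ∀ e, Γ'.right (onE e) = onV₂ (Γ.right e)

/-- The automorphisms of a bipartite graph. -/
abbrev Aut (Γ : BipartiteGraph) : Type := Iso Γ Γ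

/-- The number of automorphisms of a bipartite graph. -/
def autCard (Γ : BipartiteGraph) : ℕ := Nat.card Γ.Aut

/-- Two bipartite graphs are isomorphic. -/
def IsIso (Γ Γ' : BipartiteGraph) : Prop := Nonempty (Iso Γ Γ')

theorem isIso_equivalence : Equivalence IsIso where
  refl Γ := ⟨⟨Equiv.refl _, Equiv.refl _, Equiv.refl _, fun _ => rfl, fun _ => rfl⟩⟩
  symm := by
    rintro Γ Γ' ⟨f⟩
    refine ⟨⟨f.onV₁.symm, f.onE.symm, f.onV₂.symm, fun e => ?_, fun e => ?_⟩⟩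
    · rw [Equiv.eq_symm_apply, ← f.left_comm, Equiv.apply_symm_apply]
    · rw [Equiv.eq_symm_apply, ← f.right_comm, Equiv.apply_symm_apply]
  trans := by
    rintro Γ Γ' Γ'' ⟨f⟩ ⟨g⟩
    exact ⟨⟨f.onV₁.trans g.onV₁, f.onE.trans g.onE, f.onV₂.trans g.onV₂,
      fun e => by simp [g.left_comm, f.left_comm],
      fun e => by simp [g.right_comm, f.right_comm]⟩⟩

/-- The graph on the set of all vertices, two vertices being adjacent when an edge joins them. -/
def toSimpleGraph (Γ : BipartiteGraph) : SimpleGraph (Γ.V₁ ⊕ Γ.V₂) :=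
  SimpleGraph.fromRel fun a b => ∃ e, a = Sum.inl (Γ.left e) ∧ b = Sum.inr (Γ.right e)

/-- A bipartite graph is simple when every connected component has exactly two vertices
(with any positive number of edges between them). -/
def IsSimple (Γ : BipartiteGraph) : Prop :=
  ∀ c : Γ.toSimpleGraph.ConnectedComponent, c.supp.ncard = 2

/-- The disjoint union of two bipartite graphs. -/
def disjUnion (Γ Γ' : BipartiteGraph) : BipartiteGraph where
  V₁ := Γ.V₁ ⊕ Γ'.V₁
  E := Γ.E ⊕ Γ'.E
  V₂ := Γ.V₂ ⊕ Γ'.V₂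
  finE := inferInstance
  left := Sum.map Γ.left Γ'.left
  right := Sum.map Γ.right Γ'.right
  left_surj := Γ.left_surj.sumMap Γ'.left_surj
  right_surj := Γ.right_surj.sumMap Γ'.right_surj

theorem degree_disjUnion (Γ Γ' : BipartiteGraph) :
    (disjUnion Γ Γ').degree = Γ.degree + Γ'.degree :=
  Nat.card_sum

/-- A pair `(χ, F)`, where `χ : V₂ → V₁'` preserves the valency of vertices and `F` is a bijection
of the edges (a subset of `E × E'` projecting bijectively to both factors) that is consistent
with `χ`. -/
@[ext]
structure Gluing (Γ Γ' : BipartiteGraph) where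
  χ : Γ.V₂ → Γ'.V₁
  valency : ∀ v, Nat.card {e' // Γ'.left e' = χ v} = Nat.card {e // Γ.right e = v}
  F : Γ.E ≃ Γ'.E
  consistent : ∀ e, χ (Γ.right e) = Γ'.left (F e)

instance (Γ Γ' : BipartiteGraph) : Finite (Gluing Γ Γ') :=
  Finite.of_injective (fun g => (g.χ, g.F)) fun g g' h => by
    simp only [Prod.mk.injEq] at h
    exact Gluing.ext h.1 h.2

namespace Gluing

variable {Γ Γ' : BipartiteGraph}

/-- The bipartite graph `(V₁, F̄, V₂')`: an edge is a pair `(e, e') ∈ F` glued together, labelled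
here by `e`. -/
def glued (g : Gluing Γ Γ') : BipartiteGraph where
  V₁ := Γ.V₁
  E := Γ.E
  V₂ := Γ'.V₂
  finE := inferInstance
  left := Γ.left
  right := fun e => Γ'.right (g.F e)
  left_surj := Γ.left_surj
  right_surj := Γ'.right_surj.comp g.F.surjective

/-- The number of those automorphisms of `(V₁, F̄, V₂')` that induce on the set `E` an automorphism
of the graph `(V₁, E, V₂)`. -/
def autFCard (g : Gluing Γ Γ') : ℕ :=
  Nat.card {σ : g.glued.Aut // ∃ τ : Γ.Aut, ∀ e : Γ.E, τ.onE e = σ.onE e}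

/-- Two gluings are equivalent when automorphisms of the two graphs carry one to the other. -/
def equiv (Γ Γ' : BipartiteGraph) : Setoid (Gluing Γ Γ') where
  r g h := ∃ (a : Γ.Aut) (a' : Γ'.Aut), ∀ e, h.F (a.onE e) = a'.onE (g.F e)
  iseqv :=
    { refl := fun _ => ⟨⟨Equiv.refl _, Equiv.refl _, Equiv.refl _, fun _ => rfl, fun _ => rfl⟩,
        ⟨Equiv.refl _, Equiv.refl _, Equiv.refl _, fun _ => rfl, fun _ => rfl⟩, fun _ => rfl⟩
      symm := by
        rintro g h ⟨a, a', H⟩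
        refine ⟨⟨a.onV₁.symm, a.onE.symm, a.onV₂.symm, fun e => ?_, fun e => ?_⟩,
          ⟨a'.onV₁.symm, a'.onE.symm, a'.onV₂.symm, fun e => ?_, fun e => ?_⟩, fun e => ?_⟩
        · rw [Equiv.eq_symm_apply, ← a.left_comm, Equiv.apply_symm_apply]
        · rw [Equiv.eq_symm_apply, ← a.right_comm, Equiv.apply_symm_apply]
        · rw [Equiv.eq_symm_apply, ← a'.left_comm, Equiv.apply_symm_apply]
        · rw [Equiv.eq_symm_apply, ← a'.right_comm, Equiv.apply_symm_apply]
        · rw [Equiv.eq_symm_apply, ← H, Equiv.apply_symm_apply]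
      trans := by
        rintro g h k ⟨a, a', H⟩ ⟨b, b', K⟩
        exact ⟨⟨a.onV₁.trans b.onV₁, a.onE.trans b.onE, a.onV₂.trans b.onV₂,
            fun e => by simp [a.left_comm, b.left_comm],
            fun e => by simp [a.right_comm, b.right_comm]⟩,
          ⟨a'.onV₁.trans b'.onV₁, a'.onE.trans b'.onE, a'.onV₂.trans b'.onV₂,
            fun e => by simp [a'.left_comm, b'.left_comm],
            fun e => by simp [a'.right_comm, b'.right_comm]⟩,
          fun e => by simp [H, K]⟩ }

end Gluing

/-- Isomorphism as an equivalence relation on the bipartite graphs of degree `n`. -/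
def isoSetoid (n : ℕ) : Setoid {Γ : BipartiteGraph // Γ.degree = n} where
  r Γ Γ' := IsIso Γ.1 Γ'.1
  iseqv :=
    { refl := fun Γ => isIso_equivalence.refl Γ.1
      symm := fun h => isIso_equivalence.symm h
      trans := fun h k => isIso_equivalence.trans h k }

/-- The set of isomorphism classes of bipartite graphs of degree `n`. -/
def Classes (n : ℕ) : Type 1 := Quotient (isoSetoid n)

namespace Classes

/-- The isomorphism class of a graph. -/
def mk {n : ℕ} (Γ : BipartiteGraph) (h : Γ.degree = n) : Classes n :=
  Quotient.mk (isoSetoid n) ⟨Γ, h⟩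

/-- A graph in a given isomorphism class. -/
def rep {n : ℕ} (x : Classes n) : BipartiteGraph := (Quotient.out x).1

theorem degree_rep {n : ℕ} (x : Classes n) : x.rep.degree = n := (Quotient.out x).2

theorem mk_rep {n : ℕ} (x : Classes n) : mk x.rep x.degree_rep = x := Quotient.out_eq x

theorem rep_mk {n : ℕ} (Γ : BipartiteGraph) (h : Γ.degree = n) : IsIso (mk Γ h).rep Γ :=
  Quotient.mk_out (s := isoSetoid n) ⟨Γ, h⟩

instance (n : ℕ) : Finite (Classes n) := by
  have hS : Finite (Setoid (Fin n)) :=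
    Finite.of_injective (fun s : Setoid (Fin n) => fun a b => s.r a b) fun s t h => by
      ext a b
      exact iff_of_eq (congrFun (congrFun h a) b)
  let f : Setoid (Fin n) × Setoid (Fin n) → Classes n := fun p =>
    mk { V₁ := Quotient p.1, E := Fin n, V₂ := Quotient p.2, finE := inferInstance,
         left := Quotient.mk _, right := Quotient.mk _,
         left_surj := Quotient.mk_surjective, right_surj := Quotient.mk_surjective }
      (Nat.card_fin n)
  refine Finite.of_surjective f fun x => ?_
  have hd := x.degree_rep
  let e : x.rep.E ≃ Fin n := Finite.equivFinOfCardEq hd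
  have hl : Function.Surjective (fun i => x.rep.left (e.symm i)) :=
    x.rep.left_surj.comp e.symm.surjective
  have hr : Function.Surjective (fun i => x.rep.right (e.symm i)) :=
    x.rep.right_surj.comp e.symm.surjective
  refine ⟨(Setoid.ker fun i => x.rep.left (e.symm i), Setoid.ker fun i => x.rep.right (e.symm i)), ?_⟩
  refine Eq.trans ?_ (mk_rep x)
  refine Quotient.sound (s := isoSetoid n) ⟨⟨Setoid.quotientKerEquivOfSurjective _ hl, e.symm,
    Setoid.quotientKerEquivOfSurjective _ hr, fun i => rfl, fun i => rfl⟩⟩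

instance (n : ℕ) : Fintype (Classes n) := Fintype.ofFinite _

end Classes

/-- The complex vector space `B_n` with basis the isomorphism classes of bipartite graphs of
degree `n`. -/
def B (n : ℕ) : Type 1 := Classes n →₀ ℂ

instance (n : ℕ) : AddCommGroup (B n) := inferInstanceAs (AddCommGroup (Classes n →₀ ℂ))
instance (n : ℕ) : Module ℂ (B n) := inferInstanceAs (Module ℂ (Classes n →₀ ℂ))

/-- The basis vector of `B_n` given by an isomorphism class. -/
def vec {n : ℕ} (x : Classes n) : B n := (Finsupp.single x 1 : Classes n →₀ ℂ)

/-- The linear map on `B_n` with prescribed values on the basis. -/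
def liftB {n : ℕ} {M : Type 1} [AddCommGroup M] [Module ℂ M] (f : Classes n → M) : B n →ₗ[ℂ] M :=
  (Finsupp.linearCombination ℂ f : (Classes n →₀ ℂ) →ₗ[ℂ] M)

open Classical in
instance (Γ Γ' : BipartiteGraph) : Fintype (Quotient (Gluing.equiv Γ Γ')) := Fintype.ofFinite _

/-- The product of two graphs in `B_n`: the sum over the gluings `(χ, F)`, up to equivalence, of
`(|Aut (V₁, F̄, V₂')| / |Aut_F (V₁, F̄, V₂')|) [(V₁, F̄, V₂')]`. The summand does not depend on the
choice of representatives. -/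
def mulVec {n : ℕ} (x y : Classes n) : B n :=
  ∑ q : Quotient (Gluing.equiv x.rep y.rep),
    ((q.out.glued.autCard : ℂ) / (q.out.autFCard : ℂ)) •
      vec (Classes.mk (n := n) q.out.glued x.degree_rep)

/-- The product of `B_n`, extended bilinearly. -/
def mulB (n : ℕ) : B n →ₗ[ℂ] B n →ₗ[ℂ] B n := liftB fun x => liftB fun y => mulVec x y

instance (n : ℕ) : NonUnitalNonAssocRing (B n) :=
  { (inferInstance : AddCommGroup (B n)) with
    mul := fun a b => mulB n a b
    left_distrib := fun a b c => map_add (mulB n a) b c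
    right_distrib := fun a b c => LinearMap.map_add₂ (mulB n) a b c
    zero_mul := fun a => LinearMap.map_zero₂ (mulB n) a
    mul_zero := fun a => map_zero (mulB n a) }

instance (n : ℕ) : IsScalarTower ℂ (B n) (B n) :=
  ⟨fun z a b => LinearMap.map_smul₂ (mulB n) z a b⟩

instance (n : ℕ) : SMulCommClass ℂ (B n) (B n) :=
  ⟨fun z a b => (map_smul (mulB n a) z b).symm⟩

open Classical in
instance (n : ℕ) : Fintype {s : Classes n // s.rep.IsSimple} := Fintype.ofFinite _

/-- `ρ_n` of a graph `Γ` of degree `m ≤ n`.  The standard extensions of degree `n` of `Γ` are the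
graphs `Γ ⊔ S` with `S` simple of degree `n - m`; the coefficient of such a graph is
`|Aut (Γ ⊔ S)| / (|Aut Γ| |Aut S|)`. -/
def rhoVec {m n : ℕ} (h : m ≤ n) (x : Classes m) : B n :=
  ∑ s : {s : Classes (n - m) // s.rep.IsSimple},
    (((disjUnion x.rep s.1.rep).autCard : ℂ) / ((x.rep.autCard : ℂ) * (s.1.rep.autCard : ℂ))) •
      vec (Classes.mk (n := n) (disjUnion x.rep s.1.rep) (by
        rw [degree_disjUnion, Classes.degree_rep, Classes.degree_rep, Nat.add_sub_cancel' h]))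

/-- The linear map `ρ_n : B_m → B_n` for `m ≤ n`. -/
def rho {m n : ℕ} (h : m ≤ n) : B m →ₗ[ℂ] B n := liftB (rhoVec h)

/-- The elements `{Γ₁ Γ₂}_n` of `B_n`: for `n ≥ max (|Γ₁|, |Γ₂|)`,
`{Γ₁ Γ₂}_n = ρ_n(Γ₁) * ρ_n(Γ₂) - ∑ ρ_n({Γ₁ Γ₂}_k)`, the sum over `max (|Γ₁|, |Γ₂|) ≤ k < n`
(empty for `n = max (|Γ₁|, |Γ₂|)`). -/
def bracket {p q : ℕ} (x : Classes p) (y : Classes q) (n : ℕ) : B n :=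
  if h : max p q ≤ n then
    rho ((le_max_left p q).trans h) (vec x) * rho ((le_max_right p q).trans h) (vec y) -
      ∑ k : Fin n, if max p q ≤ (k : ℕ) then rho k.2.le (bracket x y (k : ℕ)) else 0
  else 0
termination_by n
decreasing_by exact k.2

/-- The vector space `B_∞` generated by all bipartite graphs (of positive degree). -/
def BInf : Type 1 := (Σ n : ℕ+, Classes n) →₀ ℂ

instance : AddCommGroup BInf := inferInstanceAs (AddCommGroup ((Σ n : ℕ+, Classes n) →₀ ℂ))
instance : Module ℂ BInf := inferInstanceAs (Module ℂ ((Σ n : ℕ+, Classes n) →₀ ℂ))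

/-- The linear map on `B_∞` with prescribed values on the basis. -/
def liftInf {M : Type 1} [AddCommGroup M] [Module ℂ M] (f : (Σ n : ℕ+, Classes n) → M) :
    BInf →ₗ[ℂ] M :=
  (Finsupp.linearCombination ℂ f : ((Σ n : ℕ+, Classes n) →₀ ℂ) →ₗ[ℂ] M)

/-- The inclusion of `B_n` into `B_∞`. -/
def incl (n : ℕ+) : B n →ₗ[ℂ] BInf :=
  liftB fun x => (Finsupp.single ⟨n, x⟩ 1 : (Σ n : ℕ+, Classes n) →₀ ℂ)

/-- `Γ₁ ∘ Γ₂ = ∑ {Γ₁ Γ₂}_n`, a sum with finitely many nonzero terms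
(the terms with `n < max (|Γ₁|, |Γ₂|)` are zero). -/
def circVec (x y : Σ n : ℕ+, Classes n) : BInf :=
  ∑ᶠ n : ℕ+, incl n (bracket x.2 y.2 n)

/-- The product `∘` of `B_∞`, extended bilinearly. -/
def circ : BInf →ₗ[ℂ] BInf →ₗ[ℂ] BInf := liftInf fun x => liftInf fun y => circVec x y

instance : NonUnitalNonAssocRing BInf :=
  { (inferInstance : AddCommGroup BInf) with
    mul := fun a b => circ a b
    left_distrib := fun a b c => map_add (circ a) b c
    right_distrib := fun a b c => LinearMap.map_add₂ circ a b c
    zero_mul := fun a => LinearMap.map_zero₂ circ a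
    mul_zero := fun a => map_zero (circ a) }

instance : IsScalarTower ℂ (BInf) (BInf) :=
  ⟨fun z a b => LinearMap.map_smul₂ (circ) z a b⟩

instance : SMulCommClass ℂ (BInf) (BInf) :=
  ⟨fun z a b => (map_smul (circ a) z b).symm⟩

/-- The algebra `B^as` of sequences `(b¹, b², …)` with `bⁿ ∈ B_n`, with componentwise operations. -/
abbrev BAs : Type 1 := ∀ n : ℕ+, B n

/-- The sequence associated with `b ∈ B_n`: its `i`-th entry is `0` for `i < n` and `ρ_i(b)` for
`i ≥ n`. -/
def asSeq {n : ℕ+} (b : B n) : BAs := fun i => if h : (n : ℕ) ≤ i then rho h b else 0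

end BipartiteGraph

end

/-
A graph is a pair of partitions `(P, R)` of its edge set. Recording the coefficients of an element
of `B_n` in a matrix indexed by the partitions of an `n`-element set turns `*` into the matrix
product, the partition summed over being the one along which two graphs are glued: the ratios of
orders of automorphism groups are exactly what is needed to count labellings instead of isomorphism
classes. Likewise, the entry of `ρ_n(x)` at `(P, R)` is a sum over the subsets `T` off which `P` and
`R` agree. Hence the entry of `ρ_n(x) * ρ_n(y)` counts triples `(Q, T, T')`, and by induction on `n`
the entry of `{xy}_n` counts those for which `T` and `T'` cover all edges; there are none if
`n > |x| + |y|`. The recursion for `{xy}_n` says that `ρ_↑` is multiplicative. It is injective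
since a term of minimal degree survives, so `∘` inherits associativity from `*`.
-/

noncomputable section

namespace BipartiteGraph

open scoped Classical

attribute [local instance] Fintype.ofFinite

instance (E : Type*) [Finite E] : Finite (Setoid E) :=
  Finite.of_injective (fun P : Setoid E => P.r) fun _ _ h => Setoid.ext fun a b =>
    iff_of_eq (congrFun₂ h a b)

theorem comap_symm_eq_iff {α β : Type*} {P : Setoid α} {Q : Setoid β} {e : α ≃ β} :
    P.comap e.symm = Q ↔ Q.comap e = P := by
  constructor <;> rintro rfl <;> rw [← Setoid.comap_comp] <;> simp [Setoid.comap_id]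

/-- The bijection between the targets of two surjections whose fibres correspond under `e`. -/
def targetEquiv {α β X Y : Type*} {f : α → X} {g : β → Y} (hf : Function.Surjective f)
    (hg : Function.Surjective g) (e : α ≃ β) (h : (Setoid.ker g).comap e = Setoid.ker f) : X ≃ Y :=
  (Setoid.quotientKerEquivOfSurjective f hf).symm.trans <|
    (Quotient.congr e fun a b => (Setoid.ext_iff.1 h a b).symm).trans
      (Setoid.quotientKerEquivOfSurjective g hg)

theorem targetEquiv_apply {α β X Y : Type*} {f : α → X} {g : β → Y} (hf : Function.Surjective f)
    (hg : Function.Surjective g) (e : α ≃ β) (h : (Setoid.ker g).comap e = Setoid.ker f) (a : α) :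
    targetEquiv hf hg e h (f a) = g (e a) := by
  have : (Setoid.quotientKerEquivOfSurjective f hf).symm (f a) = Quotient.mk _ a :=
    (Equiv.symm_apply_eq _).2 rfl
  rw [targetEquiv, Equiv.trans_apply, this]
  rfl

/-- The partition of the edges by their ends in `V₁`. -/
def leftRel (Γ : BipartiteGraph) : Setoid Γ.E := Setoid.ker Γ.left

/-- The partition of the edges by their ends in `V₂`. -/
def rightRel (Γ : BipartiteGraph) : Setoid Γ.E := Setoid.ker Γ.right

theorem leftRel_apply {Γ : BipartiteGraph} {a b : Γ.E} :
    Γ.leftRel a b ↔ Γ.left a = Γ.left b := Iff.rfl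

theorem rightRel_apply {Γ : BipartiteGraph} {a b : Γ.E} :
    Γ.rightRel a b ↔ Γ.right a = Γ.right b := Iff.rfl

/-- A labelling of the edges of `Γ` by `E` under which the partitions of the edges by their two ends
become `P` and `R`. As every vertex is an end of some edge, this amounts to an isomorphism of `Γ`
with the bipartite graph `(E / P, E, E / R)`. -/
@[ext]
structure Labelling (Γ : BipartiteGraph) {E : Type} (P R : Setoid E) where
  toEquiv : Γ.E ≃ E
  comap_left : P.comap toEquiv = Γ.leftRel
  comap_right : R.comap toEquiv = Γ.rightRel

/-- The edges of `Γ` can be labelled by `E` so that `Γ` becomes the graph `(E / P, E, E / R)`. -/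
def IsLabelledBy (Γ : BipartiteGraph) {E : Type} (P R : Setoid E) : Prop :=
  Nonempty (Labelling Γ P R)

section Labelling

variable {Γ Γ' : BipartiteGraph} {E E' : Type} {P R : Setoid E} {P' R' : Setoid E'}

theorem Iso.onE_injective : Function.Injective (Iso.onE : Iso Γ Γ' → (Γ.E ≃ Γ'.E)) := by
  intro f g h
  refine Iso.ext (Equiv.ext fun v => ?_) h (Equiv.ext fun v => ?_)
  · obtain ⟨e, rfl⟩ := Γ.left_surj v
    rw [← f.left_comm, ← g.left_comm, h]
  · obtain ⟨e, rfl⟩ := Γ.right_surj v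
    rw [← f.right_comm, ← g.right_comm, h]

/-- An isomorphism is determined by the bijection of the edges. -/
def isoEquivLabelling : Iso Γ Γ' ≃ Labelling Γ Γ'.leftRel Γ'.rightRel where
  toFun f :=
    { toEquiv := f.onE
      comap_left := Setoid.ext fun a b => by
        rw [Setoid.comap_rel, leftRel_apply, leftRel_apply, f.left_comm, f.left_comm,
          f.onV₁.apply_eq_iff_eq]
      comap_right := Setoid.ext fun a b => by
        rw [Setoid.comap_rel, rightRel_apply, rightRel_apply, f.right_comm, f.right_comm,
          f.onV₂.apply_eq_iff_eq] }
  invFun ℓ :=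
    { onV₁ := targetEquiv Γ.left_surj Γ'.left_surj ℓ.toEquiv ℓ.comap_left
      onE := ℓ.toEquiv
      onV₂ := targetEquiv Γ.right_surj Γ'.right_surj ℓ.toEquiv ℓ.comap_right
      left_comm := fun a =>
        (targetEquiv_apply Γ.left_surj Γ'.left_surj ℓ.toEquiv ℓ.comap_left a).symm
      right_comm := fun a =>
        (targetEquiv_apply Γ.right_surj Γ'.right_surj ℓ.toEquiv ℓ.comap_right a).symm }
  left_inv _ := Iso.onE_injective rfl
  right_inv _ := rfl

namespace Labelling

instance : Finite (Labelling Γ P R) :=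
  Finite.of_injective Labelling.toEquiv fun _ _ => Labelling.ext

/-- The labelling of a graph by its own edges. -/
def refl (Γ : BipartiteGraph) : Labelling Γ Γ.leftRel Γ.rightRel := ⟨Equiv.refl _, rfl, rfl⟩

/-- Labellings by `E` and by `E'` correspond under a bijection `E ≃ E'`. -/
def relabel (e : E ≃ E') (hP : P'.comap e = P) (hR : R'.comap e = R) :
    Labelling Γ P R ≃ Labelling Γ P' R' where
  toFun ℓ := ⟨ℓ.toEquiv.trans e,
    (congrArg (Setoid.comap ℓ.toEquiv) hP).trans ℓ.comap_left,
    (congrArg (Setoid.comap ℓ.toEquiv) hR).trans ℓ.comap_right⟩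
  invFun ℓ := ⟨ℓ.toEquiv.trans e.symm,
    (congrArg (Setoid.comap ℓ.toEquiv) (comap_symm_eq_iff.2 hP)).trans ℓ.comap_left,
    (congrArg (Setoid.comap ℓ.toEquiv) (comap_symm_eq_iff.2 hR)).trans ℓ.comap_right⟩
  left_inv ℓ := Labelling.ext (by ext; simp)
  right_inv ℓ := Labelling.ext (by ext; simp)

/-- A labelling of `Γ'` identifies labellings of `Γ` by the edges of `Γ'` with labellings by the
labels. -/
def comp (ℓ : Labelling Γ' P R) : Labelling Γ Γ'.leftRel Γ'.rightRel ≃ Labelling Γ P R :=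
  relabel ℓ.toEquiv ℓ.comap_left ℓ.comap_right

theorem card_eq_autCard (ℓ : Labelling Γ P R) : Nat.card (Labelling Γ P R) = Γ.autCard :=
  (Nat.card_congr (isoEquivLabelling.trans ℓ.comp)).symm

end Labelling

theorem IsLabelledBy.isIso (h : Γ.IsLabelledBy P R) (h' : Γ'.IsLabelledBy P R) : IsIso Γ Γ' :=
  ⟨isoEquivLabelling.symm (h'.some.comp.symm h.some)⟩

theorem IsIso.isLabelledBy_iff (h : IsIso Γ Γ') : Γ.IsLabelledBy P R ↔ Γ'.IsLabelledBy P R :=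
  ⟨fun ⟨ℓ⟩ => ⟨ℓ.comp (isoEquivLabelling (isIso_equivalence.symm h).some)⟩,
    fun ⟨ℓ⟩ => ⟨ℓ.comp (isoEquivLabelling h.some)⟩⟩

theorem isLabelledBy_comap_iff (e : E ≃ E') :
    Γ.IsLabelledBy (P'.comap e) (R'.comap e) ↔ Γ.IsLabelledBy P' R' :=
  (Labelling.relabel e rfl rfl).nonempty_congr

theorem IsLabelledBy.degree_eq (h : Γ.IsLabelledBy P R) : Γ.degree = Nat.card E :=
  Nat.card_congr h.some.toEquiv

theorem autCard_ne_zero : Γ.autCard ≠ 0 := by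
  rw [← (Labelling.refl Γ).card_eq_autCard]
  exact (Nat.card_pos_iff.2 ⟨⟨Labelling.refl Γ⟩, inferInstance⟩).ne'

theorem autCard_mul_ite :
    (Γ.autCard : ℂ) * (if Γ.IsLabelledBy P R then 1 else 0) = Nat.card (Labelling Γ P R) := by
  split_ifs with h
  · rw [mul_one, h.some.card_eq_autCard]
  · rw [mul_zero, Nat.card_eq_zero.2 (.inl (not_nonempty_iff.1 h)), Nat.cast_zero]

end Labelling

section Classes

variable {n : ℕ} {E : Type} {P R : Setoid E}

theorem Classes.eq_of_isLabelledBy {x y : Classes n} (hx : x.rep.IsLabelledBy P R)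
    (hy : y.rep.IsLabelledBy P R) : x = y := by
  rw [← x.mk_rep, ← y.mk_rep]
  exact Quotient.sound (hx.isIso hy)

theorem Classes.isLabelledBy_rep_mk {Γ : BipartiteGraph} {h : Γ.degree = n} :
    (Classes.mk Γ h).rep.IsLabelledBy P R ↔ Γ.IsLabelledBy P R :=
  (Classes.rep_mk Γ h).isLabelledBy_iff

theorem Classes.exists_isLabelledBy [Finite E] (hE : Nat.card E = n) (P R : Setoid E) :
    ∃ x : Classes n, x.rep.IsLabelledBy P R := by
  let Γ : BipartiteGraph :=
    { V₁ := Quotient P, E := E, V₂ := Quotient R, finE := inferInstance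
      left := Quotient.mk P, right := Quotient.mk R
      left_surj := Quotient.mk_surjective, right_surj := Quotient.mk_surjective }
  exact ⟨.mk Γ hE, isLabelledBy_rep_mk.2
    ⟨⟨Equiv.refl E, (Setoid.ker_mk_eq P).symm, (Setoid.ker_mk_eq R).symm⟩⟩⟩

theorem Classes.exists_isLabelledBy_fin (x : Classes n) :
    ∃ P R : Setoid (Fin n), x.rep.IsLabelledBy P R := by
  let e : x.rep.E ≃ Fin n := Finite.equivFinOfCardEq x.degree_rep
  exact ⟨_, _, ⟨Labelling.relabel e (comap_symm_eq_iff.1 rfl) (comap_symm_eq_iff.1 rfl) (.refl _)⟩⟩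

/-- The isomorphism classes as a basis of `B_n`. -/
def basisB (n : ℕ) : Module.Basis (Classes n) ℂ (B n) :=
  .ofRepr (LinearEquiv.refl ℂ (Classes n →₀ ℂ))

@[simp]
theorem basisB_apply (x : Classes n) : basisB n x = vec x := rfl

@[simp]
theorem liftB_vec {M : Type 1} [AddCommGroup M] [Module ℂ M] (f : Classes n → M)
    (x : Classes n) : liftB f (vec x) = f x :=
  (Finsupp.linearCombination_single ℂ 1 x).trans (one_smul ℂ _)

@[simp]
theorem vec_mul_vec (x y : Classes n) : vec x * vec y = mulVec x y := by
  change mulB n (vec x) (vec y) = _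
  rw [mulB, liftB_vec, liftB_vec]

@[simp]
theorem rho_vec {m : ℕ} (h : m ≤ n) (x : Classes m) : rho h (vec x) = rhoVec h x := liftB_vec _ x

/-- The matrix of `b ∈ B_n` over a set of labels `E`, indexed by partitions of `E`: its entry at
`(P, R)` is the coefficient in `b` of the class of the graph `(E / P, E, E / R)`. It is zero unless
`E` has `n` elements. -/
def toMatrix (E : Type) : B n →ₗ[ℂ] Matrix (Setoid E) (Setoid E) ℂ :=
  (basisB n).constr ℂ fun x => Matrix.of fun P R => if x.rep.IsLabelledBy P R then 1 else 0

theorem toMatrix_vec (x : Classes n) (P R : Setoid E) :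
    toMatrix E (vec x) P R = if x.rep.IsLabelledBy P R then 1 else 0 := by
  rw [toMatrix, ← basisB_apply, Module.Basis.constr_basis, Matrix.of_apply]

theorem toMatrix_vec_mk {Γ : BipartiteGraph} (h : Γ.degree = n) (P R : Setoid E) :
    toMatrix E (vec (Classes.mk Γ h)) P R = if Γ.IsLabelledBy P R then 1 else 0 := by
  simp only [toMatrix_vec, Classes.isLabelledBy_rep_mk]

theorem toMatrix_eq_repr {x : Classes n} (h : x.rep.IsLabelledBy P R) (b : B n) :
    toMatrix E b P R = (basisB n).repr b x := by
  refine LinearMap.congr_fun (f := Matrix.entryLinearMap ℂ ℂ P R ∘ₗ toMatrix E)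
    (g := (basisB n).coord x) ((basisB n).ext fun y => ?_) b
  rw [LinearMap.comp_apply, Matrix.entryLinearMap_apply, basisB_apply, toMatrix_vec,
    ← basisB_apply, Module.Basis.coord_apply, Module.Basis.repr_self, Finsupp.single_apply]
  exact if_congr ⟨fun hy => Classes.eq_of_isLabelledBy hy h, fun hy => hy ▸ h⟩ rfl rfl

theorem ext_toMatrix {a b : B n} (h : toMatrix (Fin n) a = toMatrix (Fin n) b) : a = b := by
  refine (basisB n).ext_elem fun x => ?_
  obtain ⟨P, R, hx⟩ := x.exists_isLabelledBy_fin
  rw [← toMatrix_eq_repr hx, ← toMatrix_eq_repr hx, h]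

theorem toMatrix_comap {E' : Type} (e : E ≃ E') (b : B n) (P R : Setoid E') :
    toMatrix E b (P.comap e) (R.comap e) = toMatrix E' b P R := by
  refine LinearMap.congr_fun (f := Matrix.entryLinearMap ℂ ℂ (P.comap e) (R.comap e) ∘ₗ toMatrix E)
    (g := Matrix.entryLinearMap ℂ ℂ P R ∘ₗ toMatrix E') ((basisB n).ext fun x => ?_) b
  simp only [LinearMap.comp_apply, Matrix.entryLinearMap_apply, basisB_apply, toMatrix_vec,
    isLabelledBy_comap_iff]

theorem toMatrix_eq_zero (hE : Nat.card E ≠ n) : toMatrix (n := n) E = 0 := by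
  refine (basisB n).ext fun x => Matrix.ext fun P R => ?_
  rw [basisB_apply, toMatrix_vec, if_neg fun h => hE (h.degree_eq.symm.trans x.degree_rep)]
  rfl

end Classes

namespace Gluing

variable {Γ Γ' : BipartiteGraph}

theorem comap_F (g : Gluing Γ Γ') : Γ'.leftRel.comap g.F = Γ.rightRel := by
  refine Setoid.ext fun a b => ?_
  rw [Setoid.comap_rel, leftRel_apply, rightRel_apply, ← g.consistent, ← g.consistent]
  refine ⟨fun h => ?_, congrArg g.χ⟩
  -- `F` maps the edges at a vertex `v` of `V₂` injectively to the edges at `χ v`; as there are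
  -- equally many of them, it also does so surjectively.
  let f (e : {e // Γ.right e = Γ.right a}) : {e' // Γ'.left e' = g.χ (Γ.right a)} :=
    ⟨g.F e, by rw [← g.consistent, e.2]⟩
  have hf : Function.Injective f := fun e e' hee =>
    Subtype.ext (g.F.injective (congrArg Subtype.val hee))
  obtain ⟨e, he⟩ := (hf.bijective_of_nat_card_le (g.valency _).le).2
    ⟨g.F b, by rw [← g.consistent, h]⟩
  rw [← g.F.injective (congrArg Subtype.val he), e.2]

/-- The gluing given by a bijection of the edges under which the ends in `V₂` and in `V₁'`
correspond. -/
def ofEquiv (F : Γ.E ≃ Γ'.E) (h : Γ'.leftRel.comap F = Γ.rightRel) : Gluing Γ Γ' where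
  χ := targetEquiv Γ.right_surj Γ'.left_surj F h
  valency v := by
    refine Nat.card_congr (Equiv.subtypeEquiv F fun e => ?_).symm
    rw [← targetEquiv_apply Γ.right_surj Γ'.left_surj F h, Equiv.apply_eq_iff_eq]
  F := F
  consistent := targetEquiv_apply Γ.right_surj Γ'.left_surj F h

variable {E : Type} {P Q R : Setoid E}

/-- `Q` is the partition of the edges of the glued graph by the vertices along which the two graphs
are glued, for some labelling of the glued graph by `P` and `R`. -/
def IsMiddle (g : Gluing Γ Γ') (P R Q : Setoid E) : Prop :=
  ∃ γ : Labelling g.glued P R, Q.comap γ.toEquiv = Γ.rightRel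

theorem isMiddle_iff {g : Gluing Γ Γ'} : g.IsMiddle P R Q ↔
    ∃ (α : Labelling Γ P Q) (β : Labelling Γ' Q R), g.F.trans β.toEquiv = α.toEquiv := by
  constructor
  · rintro ⟨γ, hγ⟩
    refine ⟨⟨γ.toEquiv, γ.comap_left, hγ⟩, ⟨g.F.symm.trans γ.toEquiv, ?_, ?_⟩, ?_⟩
    · exact (congrArg (Setoid.comap g.F.symm) hγ).trans (comap_symm_eq_iff.2 g.comap_F)
    · exact (congrArg (Setoid.comap g.F.symm) γ.comap_right).trans (comap_symm_eq_iff.2 rfl)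
    · exact Equiv.ext fun e => congrArg γ.toEquiv (g.F.symm_apply_apply e)
  · rintro ⟨α, β, hF⟩
    refine ⟨⟨α.toEquiv, α.comap_left, ?_⟩, α.comap_right⟩
    rw [← hF]
    exact congrArg (Setoid.comap g.F) β.comap_right

theorem isMiddle_of_equiv {g h : Gluing Γ Γ'} (hgh : Gluing.equiv Γ Γ' g h)
    (hg : g.IsMiddle P R Q) : h.IsMiddle P R Q := by
  obtain ⟨a, a', haa⟩ := (Gluing.equiv Γ Γ').symm hgh
  obtain ⟨α, β, hF⟩ := isMiddle_iff.1 hg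
  refine isMiddle_iff.2 ⟨α.comp (isoEquivLabelling a), β.comp (isoEquivLabelling a'), ?_⟩
  ext e
  exact (congrArg β.toEquiv (haa e)).symm.trans (Equiv.congr_fun hF (a.onE e))

theorem equiv_of_isMiddle {g h : Gluing Γ Γ'} (hg : g.IsMiddle P R Q) (hh : h.IsMiddle P R Q) :
    Gluing.equiv Γ Γ' g h := by
  obtain ⟨α, β, hF⟩ := isMiddle_iff.1 hg
  obtain ⟨α', β', hF'⟩ := isMiddle_iff.1 hh
  refine ⟨isoEquivLabelling.symm (α'.comp.symm α), isoEquivLabelling.symm (β'.comp.symm β),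
    fun e => ?_⟩
  change h.F (α'.toEquiv.symm (α.toEquiv e)) = β'.toEquiv.symm (β.toEquiv (g.F e))
  rw [← hF, ← hF', Equiv.eq_symm_apply]
  simp

theorem exists_isMiddle (hP : Γ.IsLabelledBy P Q) (hR : Γ'.IsLabelledBy Q R) :
    ∃ g : Gluing Γ Γ', g.IsMiddle P R Q := by
  obtain ⟨⟨α⟩, ⟨β⟩⟩ := hP, hR
  refine ⟨ofEquiv (α.toEquiv.trans β.toEquiv.symm) ?_,
    isMiddle_iff.2 ⟨α, β, by ext; simp [ofEquiv]⟩⟩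
  exact (congrArg (Setoid.comap α.toEquiv) (comap_symm_eq_iff.2 β.comap_left)).trans α.comap_right

theorem sum_ite_isMiddle :
    ∑ q : Quotient (Gluing.equiv Γ Γ'), (if q.out.IsMiddle P R Q then 1 else 0 : ℂ) =
      if Γ.IsLabelledBy P Q ∧ Γ'.IsLabelledBy Q R then 1 else 0 := by
  split_ifs with h
  · obtain ⟨g, hg⟩ := exists_isMiddle h.1 h.2
    rw [Finset.sum_eq_single ⟦g⟧ (fun q _ hq => if_neg fun hq' => hq ?_) (by simp)]
    · exact if_pos (isMiddle_of_equiv ((Gluing.equiv Γ Γ').symm (Quotient.mk_out g)) hg)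
    · rw [← q.out_eq]
      exact Quotient.sound (equiv_of_isMiddle hq' hg)
  · refine Finset.sum_eq_zero fun q _ => if_neg fun hq => h ?_
    obtain ⟨α, β, -⟩ := isMiddle_iff.1 hq
    exact ⟨⟨α⟩, ⟨β⟩⟩

theorem card_labelling_fibre (g : Gluing Γ Γ') (P R Q : Setoid E) :
    Nat.card {γ : Labelling g.glued P R // Q.comap γ.toEquiv = Γ.rightRel} =
      (if g.IsMiddle P R Q then 1 else 0) * g.autFCard := by
  split_ifs with h
  · obtain ⟨γ₀, hγ₀⟩ := h
    rw [one_mul, autFCard]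
    refine Nat.card_congr (Equiv.subtypeEquiv (isoEquivLabelling.trans γ₀.comp) fun σ => ?_).symm
    have hσ : Q.comap ((isoEquivLabelling.trans γ₀.comp) σ).toEquiv = Γ.rightRel.comap σ.onE :=
      congrArg (Setoid.comap σ.onE) hγ₀
    rw [hσ]
    constructor
    · rintro ⟨τ, hτ⟩
      exact (congrArg (fun e : Γ.E ≃ Γ.E => Γ.rightRel.comap e) (Equiv.ext hτ)).symm.trans
        (isoEquivLabelling τ).comap_right
    · exact fun h => ⟨isoEquivLabelling.symm ⟨σ.onE, (isoEquivLabelling σ).comap_left, h⟩,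
        fun _ => rfl⟩
  · rw [zero_mul]
    exact Nat.card_eq_zero.2 (.inl (not_nonempty_iff.1 fun ⟨γ⟩ => h ⟨γ.1, γ.2⟩))

theorem autFCard_ne_zero (g : Gluing Γ Γ') : g.autFCard ≠ 0 := by
  have : Nonempty {σ : g.glued.Aut // ∃ τ : Γ.Aut, ∀ e, τ.onE e = σ.onE e} :=
    ⟨isoEquivLabelling.symm (.refl _), isoEquivLabelling.symm (.refl _), fun _ => rfl⟩
  have : Finite g.glued.Aut := .of_equiv _ isoEquivLabelling.symm
  exact (Nat.card_pos_iff.2 ⟨‹_›, inferInstance⟩).ne'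

theorem card_labelling_glued [Finite E] (g : Gluing Γ Γ') (P R : Setoid E) :
    Nat.card (Labelling g.glued P R) =
      (∑ Q : Setoid E, if g.IsMiddle P R Q then 1 else 0) * g.autFCard := by
  let middle (γ : Labelling g.glued P R) : Setoid E := Γ.rightRel.comap γ.toEquiv.symm
  rw [← Nat.card_congr (Equiv.sigmaFiberEquiv middle), Nat.card_sigma, Finset.sum_mul]
  refine Finset.sum_congr rfl fun Q _ => ?_
  rw [← card_labelling_fibre]
  exact Nat.card_congr (Equiv.subtypeEquivRight fun γ => comap_symm_eq_iff)

end Gluing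

theorem map_mul_of_basis {ι k A C : Type*} [CommSemiring k] [NonUnitalNonAssocSemiring A]
    [Module k A] [IsScalarTower k A A] [SMulCommClass k A A] [NonUnitalNonAssocSemiring C]
    [Module k C] [IsScalarTower k C C] [SMulCommClass k C C] (b : Module.Basis ι k A)
    (f : A →ₗ[k] C) (h : ∀ i j, f (b i * b j) = f (b i) * f (b j)) (x y : A) :
    f (x * y) = f x * f y :=
  LinearMap.congr_fun₂ (f := (LinearMap.mul k A).compr₂ f)
    (g := (LinearMap.mul k C).compl₁₂ f f) (LinearMap.ext_basis b b h) x y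

section Product

variable {n : ℕ} (E : Type) [Finite E]

theorem toMatrix_vec_mul_vec (x y : Classes n) :
    toMatrix E (vec x * vec y) = toMatrix E (vec x) * toMatrix E (vec y) := by
  ext P R
  have hterm (g : Gluing x.rep y.rep) : (g.glued.autCard : ℂ) / g.autFCard *
      toMatrix E (vec (Classes.mk (n := n) g.glued x.degree_rep)) P R =
        ∑ Q : Setoid E, if g.IsMiddle P R Q then 1 else 0 := by
    have hentry := toMatrix_vec_mk (Γ := g.glued) x.degree_rep P R
    rw [hentry, div_mul_eq_mul_div, autCard_mul_ite, div_eq_iff (mod_cast g.autFCard_ne_zero),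
      g.card_labelling_glued]
    push_cast
    rfl
  simp only [vec_mul_vec, mulVec, map_sum, map_smul, Matrix.sum_apply, Matrix.smul_apply,
    smul_eq_mul, hterm, Matrix.mul_apply]
  rw [Finset.sum_comm]
  refine Finset.sum_congr rfl fun Q _ => ?_
  rw [Gluing.sum_ite_isMiddle, toMatrix_vec, toMatrix_vec, ite_and, ite_mul, one_mul, zero_mul]

theorem toMatrix_mul (a b : B n) : toMatrix E (a * b) = toMatrix E a * toMatrix E b :=
  map_mul_of_basis (basisB n) (toMatrix E) (toMatrix_vec_mul_vec E) a b

theorem B_mul_assoc (a b c : B n) : a * b * c = a * (b * c) :=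
  ext_toMatrix (by simp only [toMatrix_mul, Matrix.mul_assoc])

end Product

theorem supp_subset_of_adj {V : Type*} {G : SimpleGraph V} {v : V} {S : Set V} (hv : v ∈ S)
    (hS : ∀ x y, G.Adj x y → x ∈ S → y ∈ S) : (G.connectedComponentMk v).supp ⊆ S := by
  intro w hw
  obtain h : Relation.ReflTransGen G.Adj v w :=
    (G.reachable_iff_reflTransGen v w).1 (SimpleGraph.ConnectedComponent.exact hw).symm
  induction h with
  | refl => exact hv
  | tail hx hxy ih =>
    exact hS _ _ hxy (ih (SimpleGraph.ConnectedComponent.sound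
      ((G.reachable_iff_reflTransGen _ _).2 hx).symm))

section IsSimple

variable {Γ : BipartiteGraph}

theorem adj_left_right (e : Γ.E) : Γ.toSimpleGraph.Adj (.inl (Γ.left e)) (.inr (Γ.right e)) :=
  (SimpleGraph.fromRel_adj _ _ _).2 ⟨Sum.inl_ne_inr, Or.inl ⟨e, rfl, rfl⟩⟩

/-- The connected component of an edge. -/
def edgeComponent (e : Γ.E) : Γ.toSimpleGraph.ConnectedComponent :=
  Γ.toSimpleGraph.connectedComponentMk (.inl (Γ.left e))

theorem inl_left_mem_supp (e : Γ.E) : .inl (Γ.left e) ∈ (edgeComponent e).supp := rfl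

theorem inr_right_mem_supp (e : Γ.E) : .inr (Γ.right e) ∈ (edgeComponent e).supp :=
  SimpleGraph.ConnectedComponent.sound (adj_left_right e).symm.reachable

theorem edgeComponent_surjective : Function.Surjective (edgeComponent (Γ := Γ)) := by
  intro c
  induction c using SimpleGraph.ConnectedComponent.ind with | _ v =>
  obtain v | v := v
  · obtain ⟨e, rfl⟩ := Γ.left_surj v
    exact ⟨e, rfl⟩
  · obtain ⟨e, rfl⟩ := Γ.right_surj v
    exact ⟨e, (inr_right_mem_supp e).symm⟩

theorem edgeComponent_eq_of_right_eq {a b : Γ.E} (h : Γ.right a = Γ.right b) :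
    edgeComponent a = edgeComponent b :=
  (inr_right_mem_supp a).symm.trans (h ▸ inr_right_mem_supp b)

theorem isSimple_iff_supp_eq : Γ.IsSimple ↔
    ∀ e : Γ.E, (edgeComponent e).supp = {.inl (Γ.left e), .inr (Γ.right e)} := by
  have hpair (e : Γ.E) : ({.inl (Γ.left e), .inr (Γ.right e)} : Set (Γ.V₁ ⊕ Γ.V₂)).ncard = 2 :=
    Set.ncard_pair Sum.inl_ne_inr
  refine edgeComponent_surjective.forall.trans (forall_congr' fun e => ⟨fun h => ?_, fun h => ?_⟩)
  · refine (Set.eq_of_subset_of_ncard_le ?_ (by rw [h, hpair]) (Set.toFinite _)).symm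
    exact Set.pair_subset (inl_left_mem_supp e) (inr_right_mem_supp e)
  · rw [h, hpair]

theorem isSimple_iff : Γ.IsSimple ↔ Γ.leftRel = Γ.rightRel := by
  rw [isSimple_iff_supp_eq]
  constructor
  · refine fun h => Setoid.ext fun a b => ⟨fun hab => ?_, fun hab => ?_⟩
    · have hmem : .inr (Γ.right b) ∈ (edgeComponent a).supp := by
        rw [edgeComponent, leftRel_apply.1 hab]
        exact inr_right_mem_supp b
      simpa [h, rightRel_apply, eq_comm] using hmem
    · have hmem : .inl (Γ.left b) ∈ (edgeComponent a).supp := by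
        rw [edgeComponent_eq_of_right_eq hab]
        exact inl_left_mem_supp b
      simpa [h, leftRel_apply, eq_comm] using hmem
  · refine fun h e => (supp_subset_of_adj (.inl rfl) fun x y hxy hx => ?_).antisymm
      (Set.pair_subset (inl_left_mem_supp e) (inr_right_mem_supp e))
    obtain ⟨-, ⟨a, rfl, rfl⟩ | ⟨a, rfl, rfl⟩⟩ := (SimpleGraph.fromRel_adj _ _ _).1 hxy
    · have ha : Γ.leftRel a e := by simpa [leftRel_apply] using hx
      rw [h] at ha
      exact .inr (congrArg _ ha)
    · have ha : Γ.rightRel a e := by simpa [rightRel_apply] using hx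
      rw [← h] at ha
      exact .inl (congrArg _ ha)

theorem IsLabelledBy.isSimple_iff {E : Type} {P R : Setoid E} (h : Γ.IsLabelledBy P R) :
    Γ.IsSimple ↔ P = R := by
  obtain ⟨ℓ⟩ := h
  rw [BipartiteGraph.isSimple_iff, ← ℓ.comap_left, ← ℓ.comap_right]
  exact (Setoid.comap_injective _ ℓ.toEquiv.surjective).eq_iff

theorem sum_simple_ite_isLabelledBy {n : ℕ} {E : Type} [Finite E] (hE : Nat.card E = n)
    (P R : Setoid E) :
    ∑ s : {s : Classes n // s.rep.IsSimple}, (if s.1.rep.IsLabelledBy P R then 1 else 0 : ℂ) =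
      if P = R then 1 else 0 := by
  obtain ⟨x, hx⟩ := Classes.exists_isLabelledBy hE P R
  split_ifs with h
  · rw [Finset.sum_eq_single ⟨x, hx.isSimple_iff.2 h⟩, if_pos hx]
    · exact fun s _ hs => if_neg fun hs' => hs (Subtype.ext (Classes.eq_of_isLabelledBy hs' hx))
    · simp
  · exact Finset.sum_eq_zero fun s _ => if_neg fun hs => h (hs.isSimple_iff.1 s.2)

end IsSimple

section Restriction

variable {E : Type*}

/-- The partition of `U` induced by a partition of `E`. -/
abbrev res (U : Set E) (P : Setoid E) : Setoid U := P.comap Subtype.val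

/-- `U` is a union of blocks of `P`. -/
def Saturated (U : Set E) (P : Setoid E) : Prop := ∀ ⦃a b⦄, P a b → (a ∈ U ↔ b ∈ U)

/-- `P` and `R` have the same blocks outside of `U`, and `U` is a union of blocks of both. Thus the
graph `(E / P, E, E / R)` is the disjoint union of its restriction to `U` and a simple graph with
edge set `Uᶜ`. -/
structure AgreeOff (U : Set E) (P R : Setoid E) : Prop where
  saturated : Saturated U P
  rel_iff : ∀ a ∉ U, ∀ b, P a b ↔ R a b

variable {U : Set E} {P Q R : Setoid E}

theorem AgreeOff.symm (h : AgreeOff U P R) : AgreeOff U R P where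
  saturated a b hab := by
    by_contra hU
    obtain ⟨ha, hb⟩ | ⟨ha, hb⟩ : (a ∉ U ∧ b ∈ U) ∨ (a ∈ U ∧ b ∉ U) := by tauto
    · exact ha ((h.saturated ((h.rel_iff a ha b).2 hab)).2 hb)
    · exact hb ((h.saturated ((h.rel_iff b hb a).2 (R.symm hab))).2 ha)
  rel_iff a ha b := (h.rel_iff a ha b).symm

theorem agreeOff_iff : AgreeOff U P R ↔
    Saturated U P ∧ Saturated U R ∧ res Uᶜ P = res Uᶜ R := by
  refine ⟨fun h => ⟨h.saturated, h.symm.saturated, Setoid.ext fun a b => h.rel_iff a a.2 b⟩,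
    fun ⟨hP, hR, h⟩ => ⟨hP, fun a ha b => ?_⟩⟩
  by_cases hb : b ∈ U
  · exact iff_of_false (fun hab => ha ((hP hab).2 hb)) (fun hab => ha ((hR hab).2 hb))
  · exact Setoid.ext_iff.1 h ⟨a, ha⟩ ⟨b, hb⟩

end Restriction

section Complement

variable {E A B X Y : Type*}

/-- The bijection `A ⊕ B ≃ E` assembled from bijections onto a subset and onto its complement. -/
def glueCompl (T : Set E) (α : A ≃ T) (β : B ≃ ↥Tᶜ) : A ⊕ B ≃ E :=
  (α.sumCongr β).trans (Equiv.Set.sumCompl T)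

theorem glueCompl_inl {T : Set E} (α : A ≃ T) (β : B ≃ ↥Tᶜ) (a : A) :
    glueCompl T α β (.inl a) = α a := rfl

theorem glueCompl_inr {T : Set E} (α : A ≃ T) (β : B ≃ ↥Tᶜ) (b : B) :
    glueCompl T α β (.inr b) = β b := rfl

theorem range_glueCompl_inl {T : Set E} (α : A ≃ T) (β : B ≃ ↥Tᶜ) :
    Set.range (fun a => glueCompl T α β (.inl a)) = T :=
  (α.surjective.range_comp Subtype.val).trans Subtype.range_coe

theorem glueCompl_eq_iff {T : Set E} {α α' : A ≃ T} {β β' : B ≃ ↥Tᶜ} :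
    glueCompl T α β = glueCompl T α' β' ↔ α = α' ∧ β = β' := by
  simp only [Equiv.ext_iff, Sum.forall, glueCompl_inl, glueCompl_inr, Subtype.ext_iff]

theorem exists_glueCompl (e : A ⊕ B ≃ E) : ∃ T α β, glueCompl T α β = e := by
  have hr : Set.range (e ∘ .inr) = (Set.range (e ∘ .inl))ᶜ := by
    rw [Set.range_comp, Set.range_comp, ← Set.image_compl_eq e.bijective,
      ← Set.isCompl_range_inl_range_inr.compl_eq]
  refine ⟨_, .ofInjective _ (e.injective.comp Sum.inl_injective),
    (Equiv.ofInjective _ (e.injective.comp Sum.inr_injective)).trans (Equiv.setCongr hr), ?_⟩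
  ext (a | b) <;> rfl

theorem comap_glueCompl_eq_ker_iff {P : Setoid E} {f : A → X} {g : B → Y} {T : Set E} {α : A ≃ T}
    {β : B ≃ ↥Tᶜ} : P.comap (glueCompl T α β) = Setoid.ker (Sum.map f g) ↔
      Saturated T P ∧ (res T P).comap α = Setoid.ker f ∧ (res Tᶜ P).comap β = Setoid.ker g := by
  have hα (a) : (α a : E) ∈ T := (α a).2
  have hβ (b) : (β b : E) ∉ T := (β b).2
  constructor
  · intro h
    have h (s t) : P (glueCompl T α β s) (glueCompl T α β t) ↔ Sum.map f g s = Sum.map f g t :=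
      Setoid.ext_iff.1 h s t
    refine ⟨fun a b hab => ?_, Setoid.ext fun a b => (h (.inl a) (.inl b)).trans Sum.inl.inj_iff,
      Setoid.ext fun a b => (h (.inr a) (.inr b)).trans Sum.inr.inj_iff⟩
    obtain ⟨s, rfl⟩ := (glueCompl T α β).surjective a
    obtain ⟨t, rfl⟩ := (glueCompl T α β).surjective b
    have hst := (h s t).1 hab
    obtain s | s := s <;> obtain t | t := t <;> simp_all [glueCompl_inl, glueCompl_inr]
  · rintro ⟨hT, hf, hg⟩
    refine Setoid.ext ?_
    rintro (a | a) (b | b)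
    · exact (Setoid.ext_iff.1 hf a b).trans Sum.inl.inj_iff.symm
    · exact iff_of_false (fun h => hβ b ((hT h).1 (hα a))) Sum.inl_ne_inr
    · exact iff_of_false (fun h => hβ a ((hT h).2 (hα b))) Sum.inr_ne_inl
    · exact (Setoid.ext_iff.1 hg a b).trans Sum.inr.inj_iff.symm

end Complement

section DisjUnion

variable {E : Type} {Γ S : BipartiteGraph} {P R : Setoid E} {T : Set E}

/-- Labellings of `Γ` and `S` by complementary sets form a labelling of `Γ ⊔ S`. -/
def Labelling.glue (hP : Saturated T P) (hR : Saturated T R)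
    (α : Labelling Γ (res T P) (res T R)) (β : Labelling S (res Tᶜ P) (res Tᶜ R)) :
    Labelling (disjUnion Γ S) P R where
  toEquiv := glueCompl T α.toEquiv β.toEquiv
  comap_left := comap_glueCompl_eq_ker_iff.2 ⟨hP, α.comap_left, β.comap_left⟩
  comap_right := comap_glueCompl_eq_ker_iff.2 ⟨hR, α.comap_right, β.comap_right⟩

/-- The set of labels of the edges of `Γ` in a labelling of `Γ ⊔ S`. -/
def Labelling.leftLabels (ℓ : Labelling (disjUnion Γ S) P R) : Set E :=
  Set.range fun a : Γ.E => ℓ.toEquiv (.inl a : Γ.E ⊕ S.E)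

theorem Labelling.exists_glue (ℓ : Labelling (disjUnion Γ S) P R) :
    ∃ hP hR α β, Labelling.glue (T := ℓ.leftLabels) hP hR α β = ℓ := by
  obtain ⟨T, α, β, hℓ⟩ := exists_glueCompl (A := Γ.E) (B := S.E) ℓ.toEquiv
  obtain rfl : ℓ.leftLabels = T :=
    (congrArg (fun e : Γ.E ⊕ S.E ≃ E => Set.range fun a => e (.inl a)) hℓ).symm.trans
      (range_glueCompl_inl α β)
  obtain ⟨hP, hαP, hβP⟩ := comap_glueCompl_eq_ker_iff.1
    ((congrArg (fun e : Γ.E ⊕ S.E ≃ E => P.comap e) hℓ).trans ℓ.comap_left)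
  obtain ⟨hR, hαR, hβR⟩ := comap_glueCompl_eq_ker_iff.1
    ((congrArg (fun e : Γ.E ⊕ S.E ≃ E => R.comap e) hℓ).trans ℓ.comap_right)
  exact ⟨hP, hR, ⟨α, hαP, hαR⟩, ⟨β, hβP, hβR⟩, Labelling.ext hℓ⟩

variable (T) in
theorem card_leftLabels_eq :
    Nat.card {ℓ : Labelling (disjUnion Γ S) P R // ℓ.leftLabels = T} =
      if Saturated T P ∧ Saturated T R then Nat.card (Labelling Γ (res T P) (res T R)) *
        Nat.card (Labelling S (res Tᶜ P) (res Tᶜ R)) else 0 := by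
  split_ifs with hT
  · rw [← Nat.card_prod]
    refine (Nat.card_congr (.ofBijective (fun p => ⟨.glue hT.1 hT.2 p.1 p.2,
      range_glueCompl_inl p.1.toEquiv p.2.toEquiv⟩) ⟨fun p p' h => ?_, ?_⟩)).symm
    · obtain ⟨hα, hβ⟩ := glueCompl_eq_iff.1 (congrArg (fun ℓ => ℓ.1.toEquiv) h)
      exact Prod.ext (Labelling.ext hα) (Labelling.ext hβ)
    · rintro ⟨ℓ, rfl⟩
      obtain ⟨hP, hR, α, β, hℓ⟩ := ℓ.exists_glue
      exact ⟨(α, β), Subtype.ext hℓ⟩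
  · refine Nat.card_eq_zero.2 (.inl ⟨?_⟩)
    rintro ⟨ℓ, rfl⟩
    obtain ⟨hP, hR, -⟩ := ℓ.exists_glue
    exact hT ⟨hP, hR⟩

theorem card_labelling_disjUnion [Finite E] : Nat.card (Labelling (disjUnion Γ S) P R) =
    ∑ T : Set E, if Saturated T P ∧ Saturated T R then
      Nat.card (Labelling Γ (res T P) (res T R)) *
        Nat.card (Labelling S (res Tᶜ P) (res Tᶜ R)) else 0 := by
  simp only [← card_leftLabels_eq]
  rw [← Nat.card_sigma, Nat.card_congr (Equiv.sigmaFiberEquiv Labelling.leftLabels)]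

end DisjUnion

section Rho

variable {m n : ℕ} {E : Type} [Finite E] {P R : Setoid E}

theorem autCard_div_mul_ite_disjUnion (Γ S : BipartiteGraph) :
    ((disjUnion Γ S).autCard / (Γ.autCard * S.autCard) : ℂ) *
        (if (disjUnion Γ S).IsLabelledBy P R then 1 else 0) =
      ∑ T : Set E, (if Saturated T P ∧ Saturated T R then 1 else 0) *
        ((if Γ.IsLabelledBy (res T P) (res T R) then 1 else 0) *
          (if S.IsLabelledBy (res Tᶜ P) (res Tᶜ R) then 1 else 0)) := by
  have hΓ : (Γ.autCard : ℂ) ≠ 0 := Nat.cast_ne_zero.2 autCard_ne_zero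
  have hS : (S.autCard : ℂ) ≠ 0 := Nat.cast_ne_zero.2 autCard_ne_zero
  rw [div_mul_eq_mul_div, autCard_mul_ite, card_labelling_disjUnion, div_eq_iff (mul_ne_zero hΓ hS),
    Finset.sum_mul, Nat.cast_sum]
  refine Finset.sum_congr rfl fun T _ => ?_
  rw [Nat.cast_ite, Nat.cast_mul, ← autCard_mul_ite, ← autCard_mul_ite, Nat.cast_zero]
  split_ifs with hT <;> ring

theorem toMatrix_rho_vec (h : m ≤ n) (hE : Nat.card E = n) (x : Classes m) :
    toMatrix E (rho h (vec x)) P R =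
      ∑ U : Set E, if AgreeOff U P R then toMatrix U (vec x) (res U P) (res U R) else 0 := by
  simp only [rho_vec, rhoVec, map_sum, map_smul, Matrix.sum_apply, Matrix.smul_apply, smul_eq_mul,
    toMatrix_vec, Classes.isLabelledBy_rep_mk, autCard_div_mul_ite_disjUnion]
  rw [Finset.sum_comm]
  refine Finset.sum_congr rfl fun U _ => ?_
  simp only [← Finset.mul_sum]
  by_cases hx : x.rep.IsLabelledBy (res U P) (res U R)
  · have hU : Nat.card ↥Uᶜ = n - m := by
      rw [← hE, ← Nat.card_congr (Equiv.Set.sumCompl U), Nat.card_sum, ← hx.degree_eq, x.degree_rep,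
        Nat.add_sub_cancel_left]
    rw [sum_simple_ite_isLabelledBy hU, if_pos hx, one_mul, ite_zero_mul_ite_zero, mul_one]
    exact if_congr (and_assoc.trans agreeOff_iff.symm) rfl rfl
  · simp only [if_neg hx, zero_mul, mul_zero, ite_self]

/-- The map `ρ_n`, extended by zero to the graphs of degree `m > n`. -/
def rhoTo (n : ℕ) : B m →ₗ[ℂ] B n := if h : m ≤ n then rho h else 0

theorem rhoTo_of_le (h : m ≤ n) : rhoTo n = rho h := dif_pos h

theorem rhoTo_of_lt (h : n < m) : rhoTo (m := m) n = 0 := dif_neg h.not_ge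

theorem toMatrix_rhoTo (hE : Nat.card E = n) (b : B m) :
    toMatrix E (rhoTo n b) P R =
      ∑ U : Set E, if AgreeOff U P R then toMatrix U b (res U P) (res U R) else 0 := by
  by_cases h : m ≤ n
  · let f : B m →ₗ[ℂ] ℂ := ∑ U : Set E, if AgreeOff U P R then
      Matrix.entryLinearMap ℂ ℂ (res U P) (res U R) ∘ₗ toMatrix U else 0
    have hf (b : B m) : f b =
        ∑ U : Set E, if AgreeOff U P R then toMatrix U b (res U P) (res U R) else 0 := by
      rw [LinearMap.sum_apply]
      refine Finset.sum_congr rfl fun U _ => ?_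
      split_ifs <;> rfl
    rw [rhoTo_of_le h, ← hf]
    exact LinearMap.congr_fun (f := Matrix.entryLinearMap ℂ ℂ P R ∘ₗ toMatrix E ∘ₗ rho h)
      ((basisB m).ext fun x => (toMatrix_rho_vec h hE x).trans (hf _).symm) b
  · rw [rhoTo_of_lt (not_le.1 h), LinearMap.zero_apply, map_zero, Matrix.zero_apply]
    refine (Finset.sum_eq_zero fun U _ => ?_).symm
    have hU : Nat.card U ≠ m := fun hU => h (hU ▸ hE ▸ Nat.card_le_card_of_injective _
      Subtype.val_injective)
    rw [toMatrix_eq_zero hU, LinearMap.zero_apply, Matrix.zero_apply, ite_self]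

end Rho

section AgreeOff

variable {E : Type*} {T T' U : Set E} {P Q Q' R : Setoid E}

theorem agreeOff_univ : AgreeOff Set.univ P R :=
  ⟨fun _ _ _ => Iff.rfl, fun a ha => (ha (Set.mem_univ a)).elim⟩

theorem AgreeOff.not_rel (h : AgreeOff U P R) {a b : E} (hab : ¬(a ∈ U ↔ b ∈ U)) : ¬R a b :=
  fun hR => hab (h.symm.saturated hR)

theorem AgreeOff.mono (h : AgreeOff T P R) (hTU : T ⊆ U) (hU : Saturated U P) : AgreeOff U P R :=
  ⟨hU, fun a ha => h.rel_iff a (mt (@hTU a) ha)⟩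

theorem AgreeOff.trans (h : AgreeOff U P Q) (h' : AgreeOff U Q R) : AgreeOff U P R :=
  ⟨h.saturated, fun a ha b => (h.rel_iff a ha b).trans (h'.rel_iff a ha b)⟩

theorem AgreeOff.saturated_union (h : AgreeOff T P Q) (h' : AgreeOff T' Q R) :
    Saturated (T ∪ T') P := by
  intro a b hab
  by_cases ha : a ∈ T
  · exact iff_of_true (.inl ha) (.inl ((h.saturated hab).1 ha))
  · exact or_congr (h.saturated hab) (h'.saturated ((h.rel_iff a ha b).1 hab))

theorem AgreeOff.eq_of_res_eq (h : AgreeOff U P Q) (h' : AgreeOff U P Q')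
    (hQ : res U Q = res U Q') : Q = Q' := by
  refine Setoid.ext fun a b => ?_
  by_cases ha : a ∈ U
  · by_cases hb : b ∈ U
    · exact Setoid.ext_iff.1 hQ ⟨a, ha⟩ ⟨b, hb⟩
    · exact iff_of_false (h.not_rel (by tauto)) (h'.not_rel (by tauto))
  · exact (h.rel_iff a ha b).symm.trans (h'.rel_iff a ha b)

theorem exists_agreeOff (hP : Saturated U P) (Q : Setoid U) :
    ∃ Q', AgreeOff U P Q' ∧ res U Q' = Q := by
  let f (a : E) : Quotient Q ⊕ Quotient P :=
    if h : a ∈ U then .inl (Quotient.mk Q ⟨a, h⟩) else .inr (Quotient.mk P a)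
  have hf (a) (ha : a ∈ U) : f a = .inl (Quotient.mk Q ⟨a, ha⟩) := dif_pos ha
  have hf' (a) (ha : a ∉ U) : f a = .inr (Quotient.mk P a) := dif_neg ha
  refine ⟨Setoid.ker f, ⟨hP, fun a ha b => ?_⟩, Setoid.ext fun a b => ?_⟩
  · rw [Setoid.ker_def, hf' a ha]
    by_cases hb : b ∈ U
    · rw [hf b hb]
      exact iff_of_false (fun hab => ha ((hP hab).2 hb)) Sum.inr_ne_inl
    · rw [hf' b hb, Sum.inr.injEq, Quotient.eq]
  · rw [Setoid.comap_rel, Setoid.ker_def, hf a a.2, hf b b.2, Sum.inl.injEq, Quotient.eq]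

theorem AgreeOff.res_iff (hU : AgreeOff U P R) (hTU : T ⊆ U) :
    AgreeOff (Subtype.val ⁻¹' T : Set U) (res U P) (res U R) ↔ AgreeOff T P R := by
  refine ⟨fun h => ⟨fun a b hab => ?_, fun a ha b => ?_⟩,
    fun h => ⟨fun a b hab => h.saturated hab, fun a ha b => h.rel_iff a ha b⟩⟩
  · by_cases ha : a ∈ U
    · exact h.saturated (a := ⟨a, ha⟩) (b := ⟨b, (hU.saturated hab).1 ha⟩) hab
    · exact iff_of_false (mt (@hTU a) ha) (mt (@hTU b) (mt (hU.saturated hab).2 ha))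
  · by_cases haU : a ∈ U
    · by_cases hbU : b ∈ U
      · exact h.rel_iff ⟨a, haU⟩ ha ⟨b, hbU⟩
      · exact iff_of_false (hU.symm.not_rel (by tauto)) (hU.not_rel (by tauto))
    · exact hU.rel_iff a haU b

end AgreeOff

section Coverings

variable {E : Type} {p q : ℕ} {x : Classes p} {y : Classes q} {T U : Set E} {P Q R : Setoid E}

/-- The graph `(E / P, E, E / Q)` is the disjoint union of a graph of class `x` with edge set `T`
and a simple graph. -/
def IsExtension (x : Classes p) (T : Set E) (P Q : Setoid E) : Prop :=
  AgreeOff T P Q ∧ x.rep.IsLabelledBy (res T P) (res T Q)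

theorem IsExtension.card_eq (h : IsExtension x T P Q) : Nat.card T = p :=
  h.2.degree_eq.symm.trans x.degree_rep

theorem isExtension_res_iff (hU : AgreeOff U P Q) (hTU : T ⊆ U) :
    IsExtension x (Subtype.val ⁻¹' T : Set U) (res U P) (res U Q) ↔ IsExtension x T P Q := by
  refine and_congr (hU.res_iff hTU) ?_
  exact isLabelledBy_comap_iff (P' := res T P) (R' := res T Q)
    (Equiv.subtypeSubtypeEquivSubtype @hTU : (Subtype.val ⁻¹' T : Set U) ≃ T)

variable [Finite E]

/-- The triples of a partition `Q` and subsets `T`, `T'` with union `U` for which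
`(E / P, E, E / Q)` and `(E / Q, E, E / R)` are the disjoint unions of graphs of classes `x` and `y`
with edge sets `T` and `T'` and of simple graphs. -/
def coverings (x : Classes p) (y : Classes q) (P R : Setoid E) (U : Set E) :
    Finset (Setoid E × Set E × Set E) :=
  {z | (IsExtension x z.2.1 P z.1 ∧ IsExtension y z.2.2 z.1 R) ∧ z.2.1 ∪ z.2.2 = U}

theorem mem_coverings {z : Setoid E × Set E × Set E} : z ∈ coverings x y P R U ↔
    (IsExtension x z.2.1 P z.1 ∧ IsExtension y z.2.2 z.1 R) ∧ z.2.1 ∪ z.2.2 = U :=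
  Finset.mem_filter_univ z

theorem agreeOff_of_mem_coverings {z : Setoid E × Set E × Set E} (hz : z ∈ coverings x y P R U) :
    AgreeOff U P z.1 ∧ AgreeOff U z.1 R := by
  obtain ⟨⟨hT, hT'⟩, rfl⟩ := mem_coverings.1 hz
  have h := hT.1.mono Set.subset_union_left (hT.1.saturated_union hT'.1)
  exact ⟨h, hT'.1.mono Set.subset_union_right h.symm.saturated⟩

theorem subset_of_mem_coverings {z : Setoid E × Set E × Set E} (hz : z ∈ coverings x y P R U) :
    z.2.1 ⊆ U ∧ z.2.2 ⊆ U :=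
  Set.union_subset_iff.1 (mem_coverings.1 hz).2.subset

/-- The restriction to `U` of a partition and two subsets. -/
def restrict (U : Set E) (z : Setoid E × Set E × Set E) : Setoid U × Set U × Set U :=
  (res U z.1, Subtype.val ⁻¹' z.2.1, Subtype.val ⁻¹' z.2.2)

theorem restrict_mem_coverings_iff {z : Setoid E × Set E × Set E} (hP : AgreeOff U P z.1)
    (hR : AgreeOff U z.1 R) (hT : z.2.1 ⊆ U) (hT' : z.2.2 ⊆ U) :
    restrict U z ∈ coverings x y (res U P) (res U R) Set.univ ↔ z ∈ coverings x y P R U := by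
  rw [mem_coverings, mem_coverings, restrict, isExtension_res_iff hP hT, isExtension_res_iff hR hT',
    ← Set.preimage_union, Set.preimage_eq_univ_iff, Subtype.range_coe]
  exact and_congr_right fun _ => (Set.union_subset hT hT').ge_iff_eq

theorem injOn_restrict : Set.InjOn (restrict U) (coverings x y P R U : Set _) := by
  rintro ⟨Q, T, T'⟩ hz ⟨Q', S, S'⟩ hz' h
  obtain ⟨hQ, hT, hT'⟩ : res U Q = res U Q' ∧ (Subtype.val ⁻¹' T : Set U) = Subtype.val ⁻¹' S ∧
      (Subtype.val ⁻¹' T' : Set U) = Subtype.val ⁻¹' S' := by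
    simpa only [restrict, Prod.mk.injEq] using h
  have hval {A B : Set E} (hA : A ⊆ U) (hB : B ⊆ U)
      (hAB : (Subtype.val ⁻¹' A : Set U) = Subtype.val ⁻¹' B) : A = B := by
    rwa [Subtype.preimage_val_eq_preimage_val_iff, Set.inter_eq_right.2 hA,
      Set.inter_eq_right.2 hB] at hAB
  obtain ⟨hTU, hTU'⟩ := subset_of_mem_coverings hz
  obtain ⟨hSU, hSU'⟩ := subset_of_mem_coverings hz'
  exact Prod.ext
    ((agreeOff_of_mem_coverings hz).1.eq_of_res_eq (agreeOff_of_mem_coverings hz').1 hQ)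
    (Prod.ext (hval hTU hSU hT) (hval hTU' hSU' hT'))

theorem card_coverings_res (hU : AgreeOff U P R) :
    (coverings x y (res U P) (res U R) Set.univ).card = (coverings x y P R U).card := by
  refine (Finset.card_nbij (restrict U) (fun z hz => ?_) injOn_restrict ?_).symm
  · obtain ⟨hP, hR⟩ := agreeOff_of_mem_coverings hz
    obtain ⟨hT, hT'⟩ := subset_of_mem_coverings hz
    exact (restrict_mem_coverings_iff hP hR hT hT').2 hz
  · rintro ⟨Q', S, S'⟩ hz'
    obtain ⟨Q, hQ, rfl⟩ := exists_agreeOff hU.saturated Q'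
    have hz : restrict U (Q, Subtype.val '' S, Subtype.val '' S') = (res U Q, S, S') := by
      simp only [restrict, Set.preimage_image_eq _ Subtype.val_injective]
    refine ⟨_, (restrict_mem_coverings_iff hQ (hQ.symm.trans hU) (Subtype.coe_image_subset U S)
      (Subtype.coe_image_subset U S')).1 (hz ▸ hz'), hz⟩

theorem toMatrix_rhoTo_vec {n : ℕ} (hE : Nat.card E = n) :
    toMatrix E (rhoTo n (vec x)) P R = ∑ T : Set E, if IsExtension x T P R then 1 else 0 := by
  refine (toMatrix_rhoTo hE _).trans (Finset.sum_congr rfl fun T _ => ?_)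
  rw [toMatrix_vec, ← ite_and]
  exact if_congr Iff.rfl rfl rfl

theorem toMatrix_rhoTo_mul_rhoTo {n : ℕ} (hE : Nat.card E = n) :
    toMatrix E (rhoTo n (vec x) * rhoTo n (vec y)) P R =
      ∑ U : Set E, ((coverings x y P R U).card : ℂ) := by
  simp only [coverings, Finset.natCast_card_filter]
  rw [Finset.sum_comm]
  calc
    _ = ∑ z : Setoid E × Set E × Set E,
        if IsExtension x z.2.1 P z.1 ∧ IsExtension y z.2.2 z.1 R then (1 : ℂ) else 0 := by
      simp only [toMatrix_mul, Matrix.mul_apply, toMatrix_rhoTo_vec hE, Finset.sum_mul_sum,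
        ite_zero_mul_ite_zero, mul_one, Fintype.sum_prod_type]
    _ = _ := Finset.sum_congr rfl fun z _ => by
      by_cases hz : IsExtension x z.2.1 P z.1 ∧ IsExtension y z.2.2 z.1 R <;> simp [hz]

theorem rhoTo_self (n : ℕ) : rhoTo (m := n) n = LinearMap.id := by
  refine LinearMap.ext fun b => ext_toMatrix (Matrix.ext fun P R => ?_)
  rw [toMatrix_rhoTo (Nat.card_fin n), Finset.sum_eq_single Set.univ, if_pos agreeOff_univ]
  · exact toMatrix_comap (Equiv.Set.univ (Fin n)) b P R
  · intro U _ hU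
    have hcard : Nat.card U ≠ n := ((Set.ncard_lt_card hU).trans_eq (Nat.card_fin n)).ne
    rw [toMatrix_eq_zero hcard, LinearMap.zero_apply, Matrix.zero_apply, ite_self]
  · simp

theorem bracket_of_lt (x : Classes p) (y : Classes q) {n : ℕ} (h : n < max p q) :
    bracket x y n = 0 := by
  rw [bracket, dif_neg h.not_ge]

theorem bracket_of_le (x : Classes p) (y : Classes q) {n : ℕ} (h : max p q ≤ n) :
    bracket x y n = rhoTo n (vec x) * rhoTo n (vec y) -
      ∑ k ∈ Finset.range n, rhoTo n (bracket x y k) := by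
  rw [bracket, dif_pos h, rhoTo_of_le (le_of_max_le_left h), rhoTo_of_le (le_of_max_le_right h),
    ← Fin.sum_univ_eq_sum_range fun k => rhoTo n (bracket x y k)]
  congr 1
  refine Finset.sum_congr rfl fun k _ => ?_
  split_ifs with hk
  · rw [rhoTo_of_le k.2.le]
  · rw [bracket_of_lt x y (not_le.1 hk), map_zero]

theorem sum_rhoTo_bracket (x : Classes p) (y : Classes q) (n : ℕ) :
    ∑ k ∈ Finset.range (n + 1), rhoTo n (bracket x y k) =
      rhoTo n (vec x) * rhoTo n (vec y) := by
  obtain h | h := le_or_gt (max p q) n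
  · rw [Finset.sum_range_succ, rhoTo_self, LinearMap.id_apply, bracket_of_le x y h,
      add_sub_cancel]
  · have hk : ∀ k ∈ Finset.range (n + 1), rhoTo n (bracket x y k) = 0 := fun k hk => by
      rw [bracket_of_lt x y ((Finset.mem_range_succ_iff.1 hk).trans_lt h), map_zero]
    rw [Finset.sum_eq_zero hk]
    obtain h | h := lt_max_iff.1 h
    · rw [rhoTo_of_lt h, LinearMap.zero_apply, zero_mul]
    · rw [rhoTo_of_lt h (m := q), LinearMap.zero_apply, mul_zero]

theorem sum_toMatrix_bracket (x : Classes p) (y : Classes q) (P R : Setoid E) :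
    (∑ U : Set E, if AgreeOff U P R then
      toMatrix U (bracket x y (Nat.card U)) (res U P) (res U R) else 0) =
      ∑ U : Set E, ((coverings x y P R U).card : ℂ) := by
  rw [← toMatrix_rhoTo_mul_rhoTo rfl, ← sum_rhoTo_bracket, map_sum, Matrix.sum_apply]
  simp only [toMatrix_rhoTo rfl]
  rw [Finset.sum_comm]
  refine Finset.sum_congr rfl fun U _ => ?_
  rw [Finset.sum_eq_single (Nat.card U)]
  · intro k _ hk
    rw [toMatrix_eq_zero hk.symm, LinearMap.zero_apply, Matrix.zero_apply, ite_self]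
  · exact fun hU => absurd (Nat.card_le_card_of_injective _ Subtype.val_injective)
      (mt Finset.mem_range_succ_iff.2 hU)

theorem toMatrix_bracket (x : Classes p) (y : Classes q) {n : ℕ} (hE : Nat.card E = n) :
    toMatrix E (bracket x y n) P R = (coverings x y P R Set.univ).card := by
  induction n using Nat.strong_induction_on generalizing E with | _ n ih =>
  -- Both sides have the same sum over all `U`, and by induction the same terms for proper `U`.
  have hproper (U : Set E) (hU : U ≠ Set.univ) : (if AgreeOff U P R then
      toMatrix U (bracket x y (Nat.card U)) (res U P) (res U R) else 0) =
        ((coverings x y P R U).card : ℂ) := by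
    split_ifs with h
    · have hlt : Nat.card U < n := (Set.ncard_lt_card hU).trans_eq hE
      rw [ih _ hlt rfl, card_coverings_res h]
    · rw [Finset.card_eq_zero.2, Nat.cast_zero]
      exact Finset.eq_empty_of_forall_notMem fun z hz =>
        h ((agreeOff_of_mem_coverings hz).1.trans (agreeOff_of_mem_coverings hz).2)
  have hsum := sum_toMatrix_bracket x y P R
  rw [← Finset.add_sum_erase _ _ (Finset.mem_univ Set.univ),
    ← Finset.add_sum_erase _ (fun U => ((coverings x y P R U).card : ℂ))
      (Finset.mem_univ Set.univ), if_pos agreeOff_univ,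
    Finset.sum_congr rfl fun U hU => hproper U (Finset.ne_of_mem_erase hU)] at hsum
  rw [← add_right_cancel hsum, Nat.card_univ, hE]
  exact (toMatrix_comap (Equiv.Set.univ E) _ P R).symm

theorem bracket_eq_zero (x : Classes p) (y : Classes q) {n : ℕ} (h : p + q < n) :
    bracket x y n = 0 := by
  refine ext_toMatrix (Matrix.ext fun P R => ?_)
  rw [toMatrix_bracket x y (Nat.card_fin n), map_zero, Matrix.zero_apply, Nat.cast_eq_zero,
    Finset.card_eq_zero]
  refine Finset.eq_empty_of_forall_notMem fun z hz => h.not_ge ?_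
  obtain ⟨⟨hT, hT'⟩, hU⟩ := mem_coverings.1 hz
  calc
    n = (z.2.1 ∪ z.2.2).ncard := by rw [hU, Set.ncard_univ, Nat.card_fin]
    _ ≤ z.2.1.ncard + z.2.2.ncard := Set.ncard_union_le _ _
    _ = p + q := congrArg₂ (· + ·) hT.card_eq hT'.card_eq

end Coverings

section BInf

/-- The graphs of positive degree as a basis of `B_∞`. -/
def basisInf : Module.Basis (Σ n : ℕ+, Classes n) ℂ BInf :=
  .ofRepr (LinearEquiv.refl ℂ ((Σ n : ℕ+, Classes n) →₀ ℂ))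

theorem liftInf_basisInf {M : Type 1} [AddCommGroup M] [Module ℂ M]
    (f : (Σ n : ℕ+, Classes n) → M) (x : Σ n : ℕ+, Classes n) : liftInf f (basisInf x) = f x :=
  (Finsupp.linearCombination_single ℂ 1 x).trans (one_smul ℂ _)

theorem basisInf_mul_basisInf (x y : Σ n : ℕ+, Classes n) :
    basisInf x * basisInf y = circVec x y := by
  change circ (basisInf x) (basisInf y) = _
  rw [circ, liftInf_basisInf, liftInf_basisInf]

theorem incl_vec (n : ℕ+) (x : Classes n) : incl n (vec x) = basisInf ⟨n, x⟩ := liftB_vec _ x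

theorem asSeq_apply {n : ℕ+} (b : B n) (i : ℕ+) : asSeq b i = rhoTo i b := by
  rw [asSeq, rhoTo]
  split_ifs <;> rfl

/-- The homomorphism `ρ_↑` of the theorem, as a linear map: the linear extension of
`b ↦ (0, …, 0, b, ρ_{n+1}(b), …)` from the graphs `b` of degree `n`. -/
def rhoUp : BInf →ₗ[ℂ] BAs := basisInf.constr ℂ fun x => asSeq (vec x.2)

theorem rhoUp_basisInf (x : Σ n : ℕ+, Classes n) : rhoUp (basisInf x) = asSeq (vec x.2) :=
  basisInf.constr_basis ℂ _ x

theorem rhoUp_incl (n : ℕ+) (b : B n) : rhoUp (incl n b) = asSeq b := by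
  funext i
  rw [asSeq_apply]
  refine LinearMap.congr_fun (f := LinearMap.proj i ∘ₗ rhoUp ∘ₗ incl n) (g := rhoTo i)
    ((basisB n).ext fun x => ?_) b
  rw [LinearMap.comp_apply, LinearMap.comp_apply, basisB_apply, incl_vec, rhoUp_basisInf,
    LinearMap.proj_apply, asSeq_apply]

theorem finsum_pnat_eq_sum_range {M : Type*} [AddCommMonoid M] {f : ℕ → M} {i : ℕ} (h0 : f 0 = 0)
    (hf : ∀ k, i < k → f k = 0) : ∑ᶠ n : ℕ+, f n = ∑ k ∈ Finset.range (i + 1), f k := by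
  rw [Finset.sum_range_succ', h0, add_zero, ← finsum_comp_equiv Equiv.pnatEquivNat.symm]
  refine finsum_eq_sum_of_support_subset _ fun k hk => Finset.mem_range.2 ?_
  by_contra hki
  exact hk (hf _ (Nat.lt_succ_of_le (not_lt.1 hki)))

theorem finite_support_incl_bracket (x y : Σ n : ℕ+, Classes n) :
    (Function.support fun n : ℕ+ => incl n (bracket x.2 y.2 n)).Finite := by
  refine (Set.finite_Iic (x.1 + y.1)).subset fun n hn => ?_
  by_contra hlt
  have hxy : (x.1 + y.1 : ℕ) < n := by exact_mod_cast not_le.1 hlt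
  exact hn (by simp only [bracket_eq_zero x.2 y.2 hxy, map_zero])

theorem rhoUp_circVec (x y : Σ n : ℕ+, Classes n) :
    rhoUp (circVec x y) = asSeq (vec x.2) * asSeq (vec y.2) := by
  funext i
  calc
    rhoUp (circVec x y) i = ∑ᶠ n : ℕ+, rhoUp (incl n (bracket x.2 y.2 n)) i :=
      ((LinearMap.proj i ∘ₗ rhoUp).toAddMonoidHom).map_finsum (finite_support_incl_bracket x y)
    _ = ∑ᶠ n : ℕ+, rhoTo i (bracket x.2 y.2 n) := by simp only [rhoUp_incl, asSeq_apply]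
    _ = ∑ k ∈ Finset.range (i + 1), rhoTo i (bracket x.2 y.2 k) := by
      refine finsum_pnat_eq_sum_range (f := fun k => rhoTo i (bracket x.2 y.2 k)) ?_ fun k hk => ?_
      · rw [bracket_of_lt x.2 y.2 (lt_max_of_lt_left x.1.pos), map_zero]
      · rw [rhoTo_of_lt hk, LinearMap.zero_apply]
    _ = asSeq (vec x.2) i * asSeq (vec y.2) i := by
      rw [sum_rhoTo_bracket, asSeq_apply, asSeq_apply]

theorem rhoUp_mul (a b : BInf) : rhoUp (a * b) = rhoUp a * rhoUp b :=
  map_mul_of_basis basisInf rhoUp (fun x y => by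
    rw [basisInf_mul_basisInf, rhoUp_circVec, rhoUp_basisInf, rhoUp_basisInf]) a b

theorem repr_asSeq_vec {i : ℕ+} (c : Classes i) {x : Σ n : ℕ+, Classes n} (h : i ≤ x.1) :
    (basisB i).repr (asSeq (vec x.2) i) c = if x = ⟨i, c⟩ then 1 else 0 := by
  obtain ⟨n, x⟩ := x
  dsimp only at h ⊢
  rw [asSeq_apply]
  obtain h | rfl := h.lt_or_eq
  · rw [rhoTo_of_lt ((PNat.coe_lt_coe i n).2 h), if_neg fun hx => h.ne' (congrArg Sigma.fst hx)]
    simp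
  · rw [rhoTo_self, LinearMap.id_apply, ← basisB_apply, Module.Basis.repr_self,
      Finsupp.single_apply]
    simp

theorem rhoUp_injective : Function.Injective rhoUp := by
  refine (injective_iff_map_eq_zero rhoUp).2 fun b hb => ?_
  by_contra hne
  obtain ⟨⟨i, c⟩, hc, hmin⟩ := (basisInf.repr b).support.exists_min_image Sigma.fst
    (Finsupp.support_nonempty_iff.2 (basisInf.repr.map_ne_zero_iff.2 hne))
  refine Finsupp.mem_support_iff.1 hc ?_
  calc
    basisInf.repr b ⟨i, c⟩
      = ∑ x ∈ (basisInf.repr b).support, basisInf.repr b x *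
          (basisB i).repr (asSeq (vec x.2) i) c := by
        rw [Finset.sum_congr rfl fun x hx => by rw [repr_asSeq_vec c (hmin x hx)]]
        simp
    _ = (basisB i).repr (rhoUp b i) c := by
        rw [rhoUp, Module.Basis.constr_apply, Finsupp.sum]
        simp
    _ = 0 := by
        rw [hb]
        simp

theorem BAs_mul_assoc (a b c : BAs) : a * b * c = a * (b * c) :=
  funext fun i => B_mul_assoc (a i) (b i) (c i)

end BInf

end BipartiteGraph

end

theorem theorem3p3 :
    -- the sums that define the product of `B_∞` are finite
    (∀ (p q : ℕ+) (x : BipartiteGraph.Classes p) (y : BipartiteGraph.Classes q) (n : ℕ),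
      (p : ℕ) + q < n → BipartiteGraph.bracket x y n = 0) ∧
    -- the products of `B_∞` and `B^as` are associative
    (∀ a b c : BipartiteGraph.BInf, a * b * c = a * (b * c)) ∧
    (∀ a b c : BipartiteGraph.BAs, a * b * c = a * (b * c)) ∧
    -- the correspondence extends to an injective homomorphism of algebras
    ∃ φ : BipartiteGraph.BInf →ₙₐ[ℂ] BipartiteGraph.BAs,
      (∀ (n : ℕ+) (b : BipartiteGraph.B n),
        φ (BipartiteGraph.incl n b) = BipartiteGraph.asSeq b) ∧
      Function.Injective φ := by
  refine ⟨fun p q x y n h => BipartiteGraph.bracket_eq_zero x y h, fun a b c => ?_,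
    BipartiteGraph.BAs_mul_assoc,
    { BipartiteGraph.rhoUp with
      map_zero' := map_zero BipartiteGraph.rhoUp
      map_mul' := BipartiteGraph.rhoUp_mul },
    BipartiteGraph.rhoUp_incl, BipartiteGraph.rhoUp_injective⟩
  refine BipartiteGraph.rhoUp_injective ?_
  simp only [BipartiteGraph.rhoUp_mul, BipartiteGraph.BAs_mul_assoc]
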